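/- Let $D,n\ge 0$ be integers and let $S_1,\dots,S_n$ be linear subspaces of $\mathbb{R}^D$ of codimensions $c_1,\dots,c_n$. For each $i$ let $B_i\in\mathbb{R}^{D\times c_i}$ be a matrix whose columns form a basis of $S_i^\perp$. For $a=(a_1,\dots,a_n)\in\mathbb{R}^{c_1}\times\cdots\times\mathbb{R}^{c_n}$ put $A_i=S_i+B_ia_i\subseteq\mathbb{R}^D$ and $\Psi=\bigcup_{i=1}^n A_i$. Let $\phi_0(x_1,\dots,x_D)=(1,x_1,\dots,x_D)\in\mathbb{R}^{D+1}$ and let $\tilde S_i$ be the linear span of $\phi_0(A_i)$ in $\mathbb{R}^{D+1}$. A family $V_1,\dots,V_n$ of linear subspaces of $\mathbb{R}^m$ (or its union) is called transversal if $\operatorname{codim}\bigcap_{i\in J}V_i=\min\{m,\sum_{i\in J}\operatorname{codim}V_i\}$ for every $J\subseteq\{1,\dots,n\}$. A finite set $X\subset\Psi$ is called in general position in $\Psi$ if $\Psi$ is the common zero set of all real polynomials of degree $n$ in $D$ variables that vanish on $X$. Theorem. Suppose that $\bigcup_{i=1}^n S_i$ is transversal. Then there is a proper algebraic variety $W\subsetneq\mathbb{R}^{c_1}\times\cdots\times\mathbb{R}^{c_n}$,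 of Lebesgue measure zero, namely the set of those $a$ for which $\bigcup_{i=1}^n\tilde S_i$ is not transversal, such that for every $a\notin W$ the following holds. Let $X\subset\Psi$ be finite and in general position in $\Psi$, let $\tilde X=\phi_0(X)$, and let $p_1,\dots,p_s$ be a basis of the vector space of homogeneous polynomials of degree $n$ in $D+1$ variables (together with $0$) that vanish on $\tilde X$. Let $i_0\in\{1,\dots,n\}$ (for instance $i_0=1$), let $x\in X\cap A_{i_0}\setminus\bigcup_{i\ne i_0}A_i$ and $\tilde x=\phi_0(x)$. Let $\tilde b_k=\nabla p_k|_{\tilde x}\in\mathbb{R}^{D+1}$ for $k=1,\dots,s$, and, after renumbering, let $\tilde b_1,\dots,\tilde b_\ell$ be a maximal linearly independent subset of $\tilde b_1,\dots,\tilde b_s$. Write $\tilde b_k=\begin{bmatrix}\gamma_k\\ b_k\end{bmatrix}$ with $\gamma_k\in\mathbb{R}$, $b_k\in\mathbb{R}^D$, and put $\gamma=[\gamma_1,\dots,\gamma_\ell]^\top$ and $B=[b_1,\dots,b_\ell]\in\mathbb{R}^{D\times\ell}$. Then $B^\top B$ is invertible and $$A_{i_0}=\operatorname{Span}(B)^\perp-B\,(B^\top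 B)^{-1}\gamma ,$$ where $\operatorname{Span}(B)$ is the span of the columns of $B$. -/

import Mathlib

open scoped Matrix

namespace AffineASC

/-- The columns of the `D × m` matrix `B` form a basis of the subspace `V` of `ℝ^D`. -/
def IsBasisMatrix {D m : ℕ} (B : Matrix (Fin D) (Fin m) ℝ)
    (V : Submodule ℝ (EuclideanSpace ℝ (Fin D))) : Prop :=
  LinearIndependent ℝ (fun j => WithLp.toLp 2 (B.col j)) ∧
    Submodule.span ℝ (Set.range fun j => WithLp.toLp 2 (B.col j)) = V

/-- The codimension of a linear subspace of `ℝ^D`. -/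
noncomputable def codim {D : ℕ} (V : Submodule ℝ (EuclideanSpace ℝ (Fin D))) : ℕ :=
  D - Module.finrank ℝ V

/-- The union of the linear subspaces `S i` of `ℝ^D` is transversal: every subfamily satisfies
`codim (⋂ S i) = min (D, ∑ codim (S i))`. -/
def IsTransversal {D n : ℕ} (S : Fin n → Submodule ℝ (EuclideanSpace ℝ (Fin D))) : Prop :=
  ∀ J : Finset (Fin n), codim (⨅ i ∈ J, S i) = min D (∑ i ∈ J, codim (S i))

/-- The affine subspace `S + B a` of `ℝ^D`. -/
noncomputable def affineTranslate {D m : ℕ} (S : Submodule ℝ (EuclideanSpace ℝ (Fin D)))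
    (B : Matrix (Fin D) (Fin m) ℝ) (a : Fin m → ℝ) :
    AffineSubspace ℝ (EuclideanSpace ℝ (Fin D)) :=
  AffineSubspace.mk' (WithLp.toLp 2 (B *ᵥ a)) S

/-- The embedding `(x₁, …, x_D) ↦ (1, x₁, …, x_D)` of `ℝ^D` into `ℝ^(D+1)`. -/
noncomputable def embed {D : ℕ} (x : EuclideanSpace ℝ (Fin D)) :
    EuclideanSpace ℝ (Fin (D + 1)) :=
  WithLp.toLp 2 (Fin.cons 1 x.ofLp)

/-- The linear subspace of `ℝ^(D+1)` induced by an affine subspace `A` of `ℝ^D`. If `A = S + μ` and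
`u₁, …, u_d` is a basis of `S`, it has the basis `(1, μ), (0, u₁), …, (0, u_d)`. -/
noncomputable def homogenize {D : ℕ} (A : AffineSubspace ℝ (EuclideanSpace ℝ (Fin D))) :
    Submodule ℝ (EuclideanSpace ℝ (Fin (D + 1))) :=
  Submodule.span ℝ (embed '' (A : Set (EuclideanSpace ℝ (Fin D))))

/-- An algebraic variety of `ℝ^(c₁) × ⋯ × ℝ^(c_n)`: the common zero set of a set of real
polynomials in the coordinates. -/
def IsAlgebraicVariety {n : ℕ} {c : Fin n → ℕ} (W : Set (∀ i, Fin (c i) → ℝ)) : Prop :=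
  ∃ P : Set (MvPolynomial (Σ i, Fin (c i)) ℝ),
    W = {a | ∀ p ∈ P, MvPolynomial.eval (fun k => a k.1 k.2) p = 0}

/-- `X` is in general position in `Ψ` with respect to degree `n`: the common zero set of the
polynomials of degree `n` that vanish on `X` is `Ψ`. -/
def InGeneralPosition {D : ℕ} (n : ℕ) (X Ψ : Set (EuclideanSpace ℝ (Fin D))) : Prop :=
  {y : EuclideanSpace ℝ (Fin D) | ∀ p : MvPolynomial (Fin D) ℝ, p.totalDegree = n →
    (∀ x ∈ X, MvPolynomial.eval x.ofLp p = 0) → MvPolynomial.eval y.ofLp p = 0} = Ψ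

/-- The vector space of the homogeneous polynomials of degree `n` (with `0`) that vanish on `Y`. -/
noncomputable def vanishingHomogeneous {m : ℕ} (n : ℕ) (Y : Set (EuclideanSpace ℝ (Fin m))) :
    Submodule ℝ (MvPolynomial (Fin m) ℝ) :=
  MvPolynomial.homogeneousSubmodule (Fin m) ℝ n ⊓
    ⨅ y ∈ Y, LinearMap.ker (MvPolynomial.aeval (R := ℝ) y.ofLp).toLinearMap

/-- The gradient of the polynomial `p` at the point `y`. -/
noncomputable def polyGradient {m : ℕ} (p : MvPolynomial (Fin m) ℝ)
    (y : EuclideanSpace ℝ (Fin m)) : EuclideanSpace ℝ (Fin m) :=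
  WithLp.toLp 2 fun j => MvPolynomial.eval y.ofLp (MvPolynomial.pderiv j p)

end AffineASC

/-!
The homogenization of `A i = S i + B i (a i)` is the preimage of `S i` under `(t, y) ↦ y - t B i
(a i)`. Hence the intersection of the homogenizations over `J` meets the hyperplane `t = 0` in the
intersection of the `S i`, and it is larger by one dimension exactly when the `A i`, `i ∈ J`, have
a common point. If the codimensions over `J` add up to at most `D`, transversality of the `S i`
makes the diagonal map of `ℝ^D` into the product of the quotients `ℝ^D ⧸ S i` surjective, so that
there always is a common point; if the sum exceeds `D`, a common point is exactly what breaks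
transversality (`isTransversal_homogenize_iff`). For such `J` the parameters that admit a common
point form a linear subspace, proper because the diagonal map cannot be surjective
(`meetingParameters_ne_top`). The exceptional set is the finite union of these proper subspaces,
whence its equations, products of linear forms, and its measure.

The recovery of `A i₀` rests on the degree of the forms being equal to the number of subspaces,
which leaves room for one linear factor through each of them. A form of degree `n` that vanishes
on the embedded points vanishes on all embedded `A i` by general position; differentiating along
lines in `A i₀`, together with Euler's identity, puts its gradient into the orthogonal complement
of the homogenization of `A i₀`. Conversely the product of a linear form `w` of that complement
with linear forms through the other homogenizations, none of them zero at the given point, has a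
gradient there that is a nonzero multiple of `w`. So the gradients span this complement
(`span_polyGradient_eq`), and a basis `(γ k, b k)` of it describes `A i₀` by the equations `γ k +
⟪b k, y⟫ = 0`, whose solution set is written down with the normal equations
(`eq_mk'_of_basis_orthogonal`).
-/

namespace AffineASC

/-! ### Homogenization of affine subspaces -/

/-- The linear inclusion `y ↦ (0, y)` of `ℝ^D` into `ℝ^(D+1)`. -/
noncomputable def inclZero (D : ℕ) :
    EuclideanSpace ℝ (Fin D) →ₗ[ℝ] EuclideanSpace ℝ (Fin (D + 1)) where
  toFun y := WithLp.toLp 2 (Fin.cons 0 y.ofLp)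
  map_add' x y := by
    ext j; refine Fin.cases ?_ (fun j => ?_) j <;> simp
  map_smul' r y := by
    ext j; refine Fin.cases ?_ (fun j => ?_) j <;> simp

@[simp] lemma inclZero_zero {D : ℕ} (y : EuclideanSpace ℝ (Fin D)) : inclZero D y 0 = 0 := rfl

@[simp] lemma inclZero_succ {D : ℕ} (y : EuclideanSpace ℝ (Fin D)) (j : Fin D) :
    inclZero D y j.succ = y j := rfl

lemma inclZero_injective (D : ℕ) : Function.Injective (inclZero D) := fun u v huv => by
  ext j
  simpa using congrArg (fun w => w j.succ) huv

@[simp] lemma embed_zero {D : ℕ} (y : EuclideanSpace ℝ (Fin D)) : embed y 0 = 1 := rfl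

@[simp] lemma embed_succ {D : ℕ} (y : EuclideanSpace ℝ (Fin D)) (j : Fin D) :
    embed y j.succ = y j := rfl

/-- The linear map `(t, y) ↦ y - t μ`, whose preimage of `S` is the homogenization of `μ + S`. -/
noncomputable def shear {D : ℕ} (μ : EuclideanSpace ℝ (Fin D)) :
    EuclideanSpace ℝ (Fin (D + 1)) →ₗ[ℝ] EuclideanSpace ℝ (Fin D) where
  toFun z := WithLp.toLp 2 (fun j => z j.succ) - z 0 • μ
  map_add' x y := by ext j; simp; ring
  map_smul' r y := by ext j; simp; ring

@[simp] lemma shear_apply {D : ℕ} (μ : EuclideanSpace ℝ (Fin D))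
    (z : EuclideanSpace ℝ (Fin (D + 1))) (j : Fin D) : shear μ z j = z j.succ - z 0 * μ j := rfl

lemma shear_embed {D : ℕ} (μ y : EuclideanSpace ℝ (Fin D)) : shear μ (embed y) = y - μ := by
  ext j; simp

lemma shear_inclZero {D : ℕ} (μ y : EuclideanSpace ℝ (Fin D)) : shear μ (inclZero D y) = y := by
  ext j; simp

lemma homogenize_mk' {D : ℕ} (μ : EuclideanSpace ℝ (Fin D))
    (S : Submodule ℝ (EuclideanSpace ℝ (Fin D))) :
    homogenize (AffineSubspace.mk' μ S) = S.comap (shear μ) := by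
  apply le_antisymm
  · refine Submodule.span_le.2 ?_
    rintro _ ⟨y, hy, rfl⟩
    simpa [shear_embed, AffineSubspace.mem_mk'] using hy
  · intro z hz
    have hz : shear μ z ∈ S := hz
    have key : z = (z 0 - 1) • embed μ + embed (shear μ z + μ) := by
      ext j; refine Fin.cases ?_ (fun j => ?_) j <;> simp
      ring
    rw [key]
    refine add_mem (Submodule.smul_mem _ _ ?_) ?_ <;>
      refine Submodule.subset_span ⟨_, ?_, rfl⟩
    · simp
    · simpa [AffineSubspace.mem_mk'] using hz

lemma embed_mem_homogenize_mk' {D : ℕ} (μ y : EuclideanSpace ℝ (Fin D))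
    (S : Submodule ℝ (EuclideanSpace ℝ (Fin D))) :
    embed y ∈ homogenize (AffineSubspace.mk' μ S) ↔ y ∈ AffineSubspace.mk' μ S := by
  simp [homogenize_mk', shear_embed, AffineSubspace.mem_mk']

/-- A subspace of `ℝ^(D+1)` that meets the hyperplane `t = 1` exceeds its part in the hyperplane
`t = 0` by one dimension. -/
lemma finrank_eq_of_embed_mem {D : ℕ} {V : Submodule ℝ (EuclideanSpace ℝ (Fin (D + 1)))}
    {y : EuclideanSpace ℝ (Fin D)} (hy : embed y ∈ V) :
    Module.finrank ℝ V = Module.finrank ℝ (V.comap (inclZero D)) + 1 := by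
  let f : V →ₗ[ℝ] ℝ := (EuclideanSpace.proj (𝕜 := ℝ) (0 : Fin (D + 1))).toLinearMap ∘ₗ V.subtype
  have hf : LinearMap.range f = ⊤ := by
    rw [LinearMap.range_eq_top]
    intro t
    exact ⟨t • ⟨embed y, hy⟩, by simp [f]⟩
  let e : V.comap (inclZero D) ≃ₗ[ℝ] LinearMap.ker f := LinearEquiv.ofBijective
    (LinearMap.codRestrict _ (LinearMap.restrict (inclZero D) (p := V.comap (inclZero D)) (q := V)
      fun _ h => h) (by intro w; simp [f]))
    ⟨fun u v huv => Subtype.ext <| inclZero_injective D <|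
      congrArg (fun w : LinearMap.ker f => (w : EuclideanSpace ℝ (Fin (D + 1)))) huv, by
      rintro ⟨⟨z, hz⟩, hz0⟩
      have hz0 : z 0 = 0 := hz0
      have hw : inclZero D (WithLp.toLp 2 fun j => z j.succ) = z := by
        ext j; refine Fin.cases ?_ (fun j => ?_) j <;> simp [hz0]
      refine ⟨⟨WithLp.toLp 2 fun j => z j.succ, by simpa [hw] using hz⟩, ?_⟩
      exact Subtype.ext (Subtype.ext hw)⟩
  have h := f.finrank_range_add_finrank_ker
  rw [hf, finrank_top, Module.finrank_self, ← e.finrank_eq] at h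
  omega

/-- A subspace of `ℝ^(D+1)` that misses the hyperplane `t = 1` lies in the hyperplane `t = 0`. -/
lemma finrank_eq_of_forall_embed_notMem {D : ℕ}
    {V : Submodule ℝ (EuclideanSpace ℝ (Fin (D + 1)))} (hV : ∀ y, embed y ∉ V) :
    Module.finrank ℝ V = Module.finrank ℝ (V.comap (inclZero D)) := by
  have hr : V ≤ LinearMap.range (inclZero D) := by
    intro z hz
    refine ⟨WithLp.toLp 2 fun j => z j.succ, ?_⟩
    have h0 : z 0 = 0 := by
      by_contra h0
      -- Scaling `z` to first coordinate `1` gives an embedded point of `V`.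
      refine hV (WithLp.toLp 2 fun j => (z 0)⁻¹ * z j.succ) ?_
      convert V.smul_mem (z 0)⁻¹ hz using 1
      ext j; refine Fin.cases ?_ (fun j => ?_) j <;> simp [h0]
    ext j; refine Fin.cases ?_ (fun j => ?_) j <;> simp [h0]
  rw [((V.comap (inclZero D)).equivMapOfInjective _ (inclZero_injective D)).finrank_eq,
    Submodule.map_comap_eq, inf_eq_right.2 hr]

/-! ### Common points of the translates -/

/-- The diagonal map of `ℝ^D` into the product of the quotients by the `S i` with `i ∈ J`. -/
noncomputable def quotDiag {D n : ℕ} (S : Fin n → Submodule ℝ (EuclideanSpace ℝ (Fin D)))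
    (J : Finset (Fin n)) :
    EuclideanSpace ℝ (Fin D) →ₗ[ℝ] (∀ i : J, EuclideanSpace ℝ (Fin D) ⧸ S i) :=
  LinearMap.pi fun i => (S i).mkQ

lemma finrank_quotDiag_codomain {D n : ℕ} (S : Fin n → Submodule ℝ (EuclideanSpace ℝ (Fin D)))
    (J : Finset (Fin n)) :
    Module.finrank ℝ (∀ i : J, EuclideanSpace ℝ (Fin D) ⧸ S i) = ∑ i ∈ J, codim (S i) := by
  rw [Module.finrank_pi_fintype, ← Finset.sum_coe_sort J]
  refine Finset.sum_congr rfl fun i _ => ?_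
  have := (S i).finrank_quotient_add_finrank
  simp only [finrank_euclideanSpace, Fintype.card_fin] at this
  unfold codim; omega

lemma finrank_range_quotDiag {D n : ℕ} (S : Fin n → Submodule ℝ (EuclideanSpace ℝ (Fin D)))
    (J : Finset (Fin n)) :
    Module.finrank ℝ (LinearMap.range (quotDiag S J)) = codim (⨅ i ∈ J, S i) := by
  have h := (quotDiag S J).finrank_range_add_finrank_ker
  have hk : LinearMap.ker (quotDiag S J) = ⨅ i ∈ J, S i := by
    ext y; simp [quotDiag, funext_iff]
  rw [hk, finrank_euclideanSpace, Fintype.card_fin] at h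
  unfold codim; omega

/-- The linear space of the parameters `a` for which the affine subspaces `S i + B i (a i)`,
`i ∈ J`, have a common point. -/
noncomputable def meetingParameters {D n : ℕ} {c : Fin n → ℕ}
    (S : Fin n → Submodule ℝ (EuclideanSpace ℝ (Fin D)))
    (B : ∀ i, Matrix (Fin D) (Fin (c i)) ℝ) (J : Finset (Fin n)) :
    Submodule ℝ (∀ i, Fin (c i) → ℝ) :=
  (LinearMap.range (quotDiag S J)).comap <| LinearMap.pi fun i : J =>
    (S i).mkQ ∘ₗ (WithLp.linearEquiv 2 ℝ (Fin D → ℝ)).symm.toLinearMap ∘ₗ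
      (B i).mulVecLin ∘ₗ LinearMap.proj (i : Fin n)

lemma mem_meetingParameters {D n : ℕ} {c : Fin n → ℕ}
    {S : Fin n → Submodule ℝ (EuclideanSpace ℝ (Fin D))}
    {B : ∀ i, Matrix (Fin D) (Fin (c i)) ℝ} {J : Finset (Fin n)} {a : ∀ i, Fin (c i) → ℝ} :
    a ∈ meetingParameters S B J ↔ ∃ y, ∀ i ∈ J, y ∈ affineTranslate (S i) (B i) (a i) := by
  simp only [meetingParameters, Submodule.mem_comap, LinearMap.mem_range, funext_iff, quotDiag,
    affineTranslate, AffineSubspace.mem_mk', Subtype.forall]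
  refine exists_congr fun y => forall₂_congr fun i _ => ?_
  simp [Submodule.Quotient.eq]

/-- Each class modulo `S` has a representative `B a` when the columns of `B` span `Sᗮ`. -/
lemma IsBasisMatrix.exists_sub_mem {D m : ℕ} {B : Matrix (Fin D) (Fin m) ℝ}
    {S : Submodule ℝ (EuclideanSpace ℝ (Fin D))} (hB : IsBasisMatrix B Sᗮ)
    (v : EuclideanSpace ℝ (Fin D)) : ∃ a, v - WithLp.toLp 2 (B *ᵥ a) ∈ S := by
  obtain ⟨s, hs, t, ht, rfl⟩ := S.exists_add_mem_mem_orthogonal v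
  rw [← hB.2, Submodule.mem_span_range_iff_exists_fun] at ht
  obtain ⟨a, rfl⟩ := ht
  refine ⟨a, ?_⟩
  convert hs
  rw [add_sub_assoc, add_eq_left, sub_eq_zero]
  ext j
  simp [Matrix.mulVec, dotProduct, mul_comm]

/-- If every parameter had a common point, the diagonal map would be surjective onto a space of
dimension `∑ i ∈ J, codim (S i) > D`. -/
lemma meetingParameters_ne_top {D n : ℕ} {c : Fin n → ℕ}
    {S : Fin n → Submodule ℝ (EuclideanSpace ℝ (Fin D))}
    {B : ∀ i, Matrix (Fin D) (Fin (c i)) ℝ} (hB : ∀ i, IsBasisMatrix (B i) (S i)ᗮ)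
    {J : Finset (Fin n)} (hJ : D < ∑ i ∈ J, codim (S i)) : meetingParameters S B J ≠ ⊤ := by
  intro h
  have hr : LinearMap.range (quotDiag S J) = ⊤ := by
    rw [eq_top_iff]
    intro w _
    have hw : ∀ i : Fin n, ∃ a : Fin (c i) → ℝ, ∀ hi : i ∈ J,
        w ⟨i, hi⟩ = (S i).mkQ (WithLp.toLp 2 (B i *ᵥ a)) := by
      intro i
      by_cases hi : i ∈ J
      · obtain ⟨v, hv⟩ := (S i).mkQ_surjective (w ⟨i, hi⟩)
        obtain ⟨a, ha⟩ := (hB i).exists_sub_mem v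
        exact ⟨a, fun _ => by rw [← hv]; exact (Submodule.Quotient.eq _).2 ha⟩
      · exact ⟨0, fun h => absurd h hi⟩
    choose a ha using hw
    have : a ∈ meetingParameters S B J := h ▸ Submodule.mem_top
    have hwa : w = fun i : J => (S i).mkQ (WithLp.toLp 2 (B i *ᵥ a i)) :=
      funext fun i => ha i i.2
    rw [hwa]
    exact this
  have h1 := finrank_range_quotDiag S J
  rw [hr, finrank_top, finrank_quotDiag_codomain] at h1
  have : codim (⨅ i ∈ J, S i) ≤ D := Nat.sub_le _ _
  omega

lemma meetingParameters_eq_top {D n : ℕ} {c : Fin n → ℕ}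
    {S : Fin n → Submodule ℝ (EuclideanSpace ℝ (Fin D))}
    (B : ∀ i, Matrix (Fin D) (Fin (c i)) ℝ) {J : Finset (Fin n)}
    (hJ : codim (⨅ i ∈ J, S i) = ∑ i ∈ J, codim (S i)) : meetingParameters S B J = ⊤ := by
  have hr : LinearMap.range (quotDiag S J) = ⊤ := by
    apply Submodule.eq_top_of_finrank_eq
    rw [finrank_range_quotDiag, finrank_quotDiag_codomain, hJ]
  rw [meetingParameters, hr, Submodule.comap_top]

/-! ### Transversality of the homogenizations -/

lemma comap_inclZero_iInf_homogenize {D n : ℕ} {c : Fin n → ℕ}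
    (S : Fin n → Submodule ℝ (EuclideanSpace ℝ (Fin D)))
    (B : ∀ i, Matrix (Fin D) (Fin (c i)) ℝ) (a : ∀ i, Fin (c i) → ℝ) (J : Finset (Fin n)) :
    (⨅ i ∈ J, homogenize (affineTranslate (S i) (B i) (a i))).comap (inclZero D) =
      ⨅ i ∈ J, S i := by
  ext y
  simp [affineTranslate, homogenize_mk', shear_inclZero]

lemma embed_mem_iInf_homogenize {D n : ℕ} {c : Fin n → ℕ}
    {S : Fin n → Submodule ℝ (EuclideanSpace ℝ (Fin D))}
    {B : ∀ i, Matrix (Fin D) (Fin (c i)) ℝ} {a : ∀ i, Fin (c i) → ℝ} {J : Finset (Fin n)} :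
    (∃ y, embed y ∈ ⨅ i ∈ J, homogenize (affineTranslate (S i) (B i) (a i))) ↔
      a ∈ meetingParameters S B J := by
  rw [mem_meetingParameters]
  simp [affineTranslate, embed_mem_homogenize_mk']

lemma codim_iInf_homogenize {D n : ℕ} {c : Fin n → ℕ}
    (S : Fin n → Submodule ℝ (EuclideanSpace ℝ (Fin D)))
    (B : ∀ i, Matrix (Fin D) (Fin (c i)) ℝ) (a : ∀ i, Fin (c i) → ℝ) (J : Finset (Fin n))
    [Decidable (a ∈ meetingParameters S B J)] :
    codim (⨅ i ∈ J, homogenize (affineTranslate (S i) (B i) (a i))) =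
      codim (⨅ i ∈ J, S i) + if a ∈ meetingParameters S B J then 0 else 1 := by
  have hle : Module.finrank ℝ (⨅ i ∈ J, S i : Submodule ℝ (EuclideanSpace ℝ (Fin D))) ≤ D := by
    simpa using Submodule.finrank_le (⨅ i ∈ J, S i)
  split_ifs with h
  · obtain ⟨y, hy⟩ := embed_mem_iInf_homogenize.2 h
    have := finrank_eq_of_embed_mem hy
    rw [comap_inclZero_iInf_homogenize] at this
    unfold codim; omega
  · have := finrank_eq_of_forall_embed_notMem
      (not_exists.1 (mt embed_mem_iInf_homogenize.1 h))
    rw [comap_inclZero_iInf_homogenize] at this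
    unfold codim; omega

lemma codim_homogenize {D m : ℕ} (S : Submodule ℝ (EuclideanSpace ℝ (Fin D)))
    (B : Matrix (Fin D) (Fin m) ℝ) (a : Fin m → ℝ) :
    codim (homogenize (affineTranslate S B a)) = codim S := by
  have hy : embed (WithLp.toLp 2 (B *ᵥ a)) ∈ homogenize (affineTranslate S B a) := by
    rw [affineTranslate, embed_mem_homogenize_mk']; simp
  have h := finrank_eq_of_embed_mem hy
  have hc : (homogenize (affineTranslate S B a)).comap (inclZero D) = S := by
    ext y; simp [affineTranslate, homogenize_mk', shear_inclZero]
  rw [hc] at h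
  unfold codim; omega

/-- The homogenizations fail to be transversal exactly when some subfamily with codimensions adding
up to more than `D` has a common point: a subfamily with a smaller sum always has one. -/
lemma isTransversal_homogenize_iff {D n : ℕ} {c : Fin n → ℕ}
    {S : Fin n → Submodule ℝ (EuclideanSpace ℝ (Fin D))}
    (B : ∀ i, Matrix (Fin D) (Fin (c i)) ℝ) (hS : IsTransversal S) (a : ∀ i, Fin (c i) → ℝ) :
    (IsTransversal fun i => homogenize (affineTranslate (S i) (B i) (a i))) ↔
      ∀ J : Finset (Fin n), D < ∑ i ∈ J, codim (S i) → a ∉ meetingParameters S B J := by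
  classical
  refine forall_congr' fun J => ?_
  rw [codim_iInf_homogenize, hS J]
  simp only [codim_homogenize]
  rcases lt_or_ge D (∑ i ∈ J, codim (S i)) with h | h
  · rw [min_eq_left h.le, min_eq_left (by omega)]
    split_ifs with ha <;> simp [h, ha]
  · have ha : a ∈ meetingParameters S B J := by
      rw [meetingParameters_eq_top B (by rw [hS J, min_eq_right h])]; trivial
    rw [min_eq_right h, min_eq_right (by omega)]
    simp [ha, h.not_gt]

/-! ### The exceptional parameters -/

/-- The linear form `f` on a product of coordinate spaces, as a polynomial. -/
noncomputable def polyOfDual {n : ℕ} {c : Fin n → ℕ} (f : Module.Dual ℝ (∀ i, Fin (c i) → ℝ)) :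
    MvPolynomial (Σ i, Fin (c i)) ℝ :=
  ∑ k, MvPolynomial.C (f (Pi.single k.1 (Pi.single k.2 1))) * MvPolynomial.X k

lemma eval_polyOfDual {n : ℕ} {c : Fin n → ℕ} (f : Module.Dual ℝ (∀ i, Fin (c i) → ℝ))
    (a : ∀ i, Fin (c i) → ℝ) :
    MvPolynomial.eval (fun k : Σ i, Fin (c i) => a k.1 k.2) (polyOfDual f) = f a := by
  have ha : a = ∑ k : Σ i, Fin (c i), a k.1 k.2 • Pi.single k.1 (Pi.single k.2 1) := by
    rw [Fintype.sum_sigma]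
    ext i j
    simp only [Finset.sum_apply]
    rw [Finset.sum_eq_single i, Finset.sum_eq_single j]
    · simp
    · intro l _ hl; simp [hl.symm]
    · simp
    · intro i' _ hi; simp [Pi.single_eq_of_ne hi.symm]
    · simp
  conv_rhs => rw [ha]
  simp [polyOfDual, mul_comm]

/-- A finite union of linear subspaces is cut out by products of linear forms. -/
lemma isAlgebraicVariety_iUnion_submodule {n : ℕ} {c : Fin n → ℕ} {ι : Type*} (s : Finset ι)
    (L : ι → Submodule ℝ (∀ i, Fin (c i) → ℝ)) :
    IsAlgebraicVariety (⋃ J ∈ s, (L J : Set (∀ i, Fin (c i) → ℝ))) := by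
  refine ⟨{p | ∀ a ∈ ⋃ J ∈ s, (L J : Set (∀ i, Fin (c i) → ℝ)),
    MvPolynomial.eval (fun k => a k.1 k.2) p = 0}, Set.Subset.antisymm
      (fun a ha p hp => hp a ha) fun a ha => ?_⟩
  by_contra hW
  simp only [Set.mem_iUnion, SetLike.mem_coe, not_exists] at hW
  have hf : ∀ J, ∃ f : Module.Dual ℝ (∀ i, Fin (c i) → ℝ),
      (∀ b ∈ L J, f b = 0) ∧ (J ∈ s → f a ≠ 0) := by
    intro J
    by_cases hJ : J ∈ s
    · obtain ⟨f, hfa, hf⟩ := Submodule.exists_le_ker_of_notMem (hW J hJ)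
      exact ⟨f, fun b hb => hf hb, fun _ => hfa⟩
    · exact ⟨0, by simp, fun h => absurd h hJ⟩
  choose f hf hfa using hf
  have h0 := ha (∏ J ∈ s, polyOfDual (f J)) (by
    intro b hb
    simp only [Set.mem_iUnion, SetLike.mem_coe] at hb
    obtain ⟨J, hJ, hb⟩ := hb
    rw [map_prod]
    exact Finset.prod_eq_zero hJ (by rw [eval_polyOfDual, hf J b hb]))
  rw [map_prod, Finset.prod_eq_zero_iff] at h0
  obtain ⟨J, hJ, h0⟩ := h0
  exact hfa J hJ (by rwa [eval_polyOfDual] at h0)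

/-- The parameters `a` for which some subfamily of the subspaces `S i + B i (a i)`, with
codimensions adding up to more than `D`, has a common point. -/
noncomputable def exceptionalParameters {D n : ℕ} {c : Fin n → ℕ}
    (S : Fin n → Submodule ℝ (EuclideanSpace ℝ (Fin D)))
    (B : ∀ i, Matrix (Fin D) (Fin (c i)) ℝ) : Set (∀ i, Fin (c i) → ℝ) :=
  ⋃ J ∈ (Finset.univ.filter fun J : Finset (Fin n) => D < ∑ i ∈ J, codim (S i)),
    (meetingParameters S B J : Set (∀ i, Fin (c i) → ℝ))

lemma notMem_exceptionalParameters_iff {D n : ℕ} {c : Fin n → ℕ}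
    {S : Fin n → Submodule ℝ (EuclideanSpace ℝ (Fin D))}
    {B : ∀ i, Matrix (Fin D) (Fin (c i)) ℝ} (hS : IsTransversal S) {a : ∀ i, Fin (c i) → ℝ} :
    a ∉ exceptionalParameters S B ↔
      IsTransversal fun i => homogenize (affineTranslate (S i) (B i) (a i)) := by
  rw [isTransversal_homogenize_iff B hS]
  simp [exceptionalParameters]

lemma volume_exceptionalParameters {D n : ℕ} {c : Fin n → ℕ}
    {S : Fin n → Submodule ℝ (EuclideanSpace ℝ (Fin D))}
    {B : ∀ i, Matrix (Fin D) (Fin (c i)) ℝ} (hB : ∀ i, IsBasisMatrix (B i) (S i)ᗮ) :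
    MeasureTheory.volume (exceptionalParameters S B) = 0 := by
  refine (MeasureTheory.measure_biUnion_null_iff (Finset.countable_toSet _)).2 fun J hJ => ?_
  exact MeasureTheory.Measure.addHaar_submodule _ _
    (meetingParameters_ne_top hB (Finset.mem_filter.1 hJ).2)

/-! ### Evaluation and gradients of polynomials -/

lemma totalDegree_aeval_le {σ τ : Type*} (f : σ → MvPolynomial τ ℝ)
    (hf : ∀ i, (f i).totalDegree ≤ 1) (p : MvPolynomial σ ℝ) :
    (MvPolynomial.aeval f p).totalDegree ≤ p.totalDegree := by
  rw [MvPolynomial.aeval_def, MvPolynomial.eval₂_eq]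
  refine MvPolynomial.totalDegree_finsetSum_le fun d hd => ?_
  refine (MvPolynomial.totalDegree_mul _ _).trans ?_
  rw [MvPolynomial.algebraMap_eq, MvPolynomial.totalDegree_C, zero_add]
  refine (MvPolynomial.totalDegree_finsetProd _ _).trans ?_
  refine le_trans (Finset.sum_le_sum fun i _ => ?_) (MvPolynomial.le_totalDegree hd)
  refine (MvPolynomial.totalDegree_pow _ _).trans ?_
  simpa using Nat.mul_le_mul_left (d i) (hf i)

/-- The chain rule for a polynomial curve. -/
lemma derivative_aeval {σ : Type*} [Fintype σ] (g : σ → Polynomial ℝ) (p : MvPolynomial σ ℝ) :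
    Polynomial.derivative (MvPolynomial.aeval g p) =
      ∑ j, Polynomial.derivative (g j) * MvPolynomial.aeval g (MvPolynomial.pderiv j p) := by
  classical
  induction p using MvPolynomial.induction_on with
  | C r => simp
  | add p q hp hq => simp [hp, hq, mul_add, Finset.sum_add_distrib]
  | mul_X p i hp =>
    have h : ∀ j, Polynomial.derivative (g j) *
        MvPolynomial.aeval g (MvPolynomial.pderiv j (p * MvPolynomial.X i)) =
        Polynomial.derivative (g j) * MvPolynomial.aeval g (MvPolynomial.pderiv j p) * g i +
          if j = i then MvPolynomial.aeval g p * Polynomial.derivative (g i) else 0 := by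
      intro j
      rw [MvPolynomial.pderiv_mul, map_add, map_mul, map_mul, MvPolynomial.aeval_X]
      split_ifs with hj
      · subst hj
        rw [MvPolynomial.pderiv_X_self, map_one]; ring
      · rw [MvPolynomial.pderiv_X_of_ne (Ne.symm hj), map_zero]; ring
    rw [Finset.sum_congr rfl fun j _ => h j, Finset.sum_add_distrib, ← Finset.sum_mul, ← hp,
      Finset.sum_ite_eq' Finset.univ i, if_pos (Finset.mem_univ i), map_mul, MvPolynomial.aeval_X,
      Polynomial.derivative_mul]

lemma sum_mul_pderiv_eq_zero_of_line {σ : Type*} [Fintype σ] (u v : σ → ℝ) (p : MvPolynomial σ ℝ)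
    (h : ∀ t : ℝ, MvPolynomial.eval (fun j => u j + v j * t) p = 0) :
    ∑ j, v j * MvPolynomial.eval u (MvPolynomial.pderiv j p) = 0 := by
  have key : ∀ (t : ℝ) (q : MvPolynomial σ ℝ), Polynomial.eval t (MvPolynomial.aeval
      (fun j => Polynomial.C (u j) + Polynomial.C (v j) * Polynomial.X) q) =
      MvPolynomial.eval (fun j => u j + v j * t) q := by
    intro t q
    induction q using MvPolynomial.induction_on with
    | C r => simp
    | add p q hp hq => simp [hp, hq]
    | mul_X p i hp => simp [hp]
  have h0 : MvPolynomial.aeval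
      (fun j => Polynomial.C (u j) + Polynomial.C (v j) * Polynomial.X) p = 0 :=
    Polynomial.funext fun t => by rw [key, h, Polynomial.eval_zero]
  have h1 := congrArg (Polynomial.eval 0) (derivative_aeval
    (fun j => Polynomial.C (u j) + Polynomial.C (v j) * Polynomial.X) p)
  rw [h0] at h1
  simpa [Polynomial.eval_finsetSum, key] using h1.symm

/-- The gradient at `y`, as a linear map. -/
noncomputable def gradientMap {m : ℕ} (y : EuclideanSpace ℝ (Fin m)) :
    MvPolynomial (Fin m) ℝ →ₗ[ℝ] EuclideanSpace ℝ (Fin m) where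
  toFun p := polyGradient p y
  map_add' p q := by ext j; simp [polyGradient]
  map_smul' r p := by ext j; simp [polyGradient, MvPolynomial.smul_eval]

lemma gradientMap_apply {m : ℕ} (y : EuclideanSpace ℝ (Fin m)) (p : MvPolynomial (Fin m) ℝ) :
    gradientMap y p = polyGradient p y := rfl

/-- The linear form `z ↦ ⟪w, z⟫`, as a polynomial. -/
noncomputable def linearForm {m : ℕ} (w : EuclideanSpace ℝ (Fin m)) : MvPolynomial (Fin m) ℝ :=
  ∑ j, MvPolynomial.C (w j) * MvPolynomial.X j

lemma eval_linearForm {m : ℕ} (w z : EuclideanSpace ℝ (Fin m)) :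
    MvPolynomial.eval z.ofLp (linearForm w) = inner ℝ w z := by
  simp [linearForm, PiLp.inner_apply, mul_comm]

lemma isHomogeneous_linearForm {m : ℕ} (w : EuclideanSpace ℝ (Fin m)) :
    (linearForm w).IsHomogeneous 1 :=
  MvPolynomial.IsHomogeneous.sum _ _ _ fun j _ => by
    simpa using (MvPolynomial.isHomogeneous_C (Fin m) (w j)).mul (MvPolynomial.isHomogeneous_X ℝ j)

lemma pderiv_linearForm {m : ℕ} (w : EuclideanSpace ℝ (Fin m)) (j : Fin m) :
    MvPolynomial.pderiv j (linearForm w) = MvPolynomial.C (w j) := by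
  classical
  simp only [linearForm, map_sum, MvPolynomial.pderiv_C_mul, MvPolynomial.pderiv_X]
  rw [Finset.sum_eq_single j]
  · simp
  · intro i _ hi; simp [hi]
  · simp

lemma polyGradient_linearForm_mul {m : ℕ} {w z : EuclideanSpace ℝ (Fin m)}
    (q : MvPolynomial (Fin m) ℝ) (h : inner ℝ w z = 0) :
    polyGradient (linearForm w * q) z = MvPolynomial.eval z.ofLp q • w := by
  ext j
  simp [polyGradient, pderiv_linearForm, eval_linearForm, h, mul_comm]

lemma inner_polyGradient {m : ℕ} (p : MvPolynomial (Fin m) ℝ) (z w : EuclideanSpace ℝ (Fin m)) :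
    inner ℝ w (polyGradient p z) =
      ∑ j, w j * MvPolynomial.eval z.ofLp (MvPolynomial.pderiv j p) := by
  simp [polyGradient, PiLp.inner_apply, mul_comm]

lemma inner_polyGradient_self {m n : ℕ} {p : MvPolynomial (Fin m) ℝ} (hp : p.IsHomogeneous n)
    {z : EuclideanSpace ℝ (Fin m)} (hz : MvPolynomial.eval z.ofLp p = 0) :
    inner ℝ z (polyGradient p z) = 0 := by
  have h := congrArg (MvPolynomial.eval z.ofLp) hp.sum_X_mul_pderiv
  rw [inner_polyGradient]
  simpa [hz] using h

lemma mem_vanishingHomogeneous {m n : ℕ} {Y : Set (EuclideanSpace ℝ (Fin m))}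
    {p : MvPolynomial (Fin m) ℝ} : p ∈ vanishingHomogeneous n Y ↔
      p.IsHomogeneous n ∧ ∀ y ∈ Y, MvPolynomial.eval y.ofLp p = 0 := by
  simp [vanishingHomogeneous, MvPolynomial.aeval_eq_eval, MvPolynomial.mem_homogeneousSubmodule]

/-! ### Forms vanishing on a set in general position -/

/-- Dehomogenizing may lower the degree; multiplying by a power of `x₀ - t`, with `t` chosen so that
this factor does not vanish at the given point, restores degree `n`. -/
lemma InGeneralPosition.eval_embed_eq_zero {D n : ℕ} {X Ψ : Set (EuclideanSpace ℝ (Fin D))}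
    (hX : InGeneralPosition n X Ψ) {x : EuclideanSpace ℝ (Fin D)} (hx : x ∈ X)
    {p : MvPolynomial (Fin (D + 1)) ℝ} (hp : p ∈ vanishingHomogeneous n (embed '' X))
    {y : EuclideanSpace ℝ (Fin D)} (hy : y ∈ Ψ) : MvPolynomial.eval (embed y).ofLp p = 0 := by
  rw [mem_vanishingHomogeneous] at hp
  obtain ⟨hpn, hpX⟩ := hp
  -- For `D = 0` there is no variable to raise the degree with, but `X` is already the whole space.
  rcases D with _ | D
  · rw [Subsingleton.elim y x]
    exact hpX _ ⟨x, hx, rfl⟩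
  let q : MvPolynomial (Fin (D + 1)) ℝ := MvPolynomial.aeval (Fin.cons 1 MvPolynomial.X) p
  have hq : ∀ z : EuclideanSpace ℝ (Fin (D + 1)),
      MvPolynomial.eval z.ofLp q = MvPolynomial.eval (embed z).ofLp p := by
    intro z
    have h := DFunLike.congr_fun (MvPolynomial.algHom_ext
      (f := (MvPolynomial.aeval z.ofLp).comp (MvPolynomial.aeval (Fin.cons 1 MvPolynomial.X)))
      (g := MvPolynomial.aeval (R := ℝ) (embed z).ofLp) fun i => by
        refine Fin.cases ?_ (fun j => ?_) i <;> simp) p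
    simpa [q, MvPolynomial.aeval_eq_eval] using h
  rw [← hq]
  by_cases hq0 : q = 0
  · simp [hq0]
  have hdeg : q.totalDegree ≤ n := by
    refine (totalDegree_aeval_le _ (fun i => ?_) p).trans hpn.totalDegree_le
    refine Fin.cases ?_ (fun j => ?_) i <;> simp
  obtain ⟨t, ht⟩ : ∃ t, y 0 - t ≠ 0 := ⟨y 0 - 1, by simp⟩
  have hne : (MvPolynomial.X 0 - MvPolynomial.C (t) : MvPolynomial (Fin (D + 1)) ℝ) ≠ 0 := by
    intro h
    exact ht (by simpa using congrArg (MvPolynomial.eval y.ofLp) h)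
  have h1 : (MvPolynomial.X 0 - MvPolynomial.C (t) :
      MvPolynomial (Fin (D + 1)) ℝ).totalDegree = 1 := by
    rw [sub_eq_add_neg, ← map_neg, MvPolynomial.totalDegree_add_eq_left_of_totalDegree_lt] <;>
      simp
  have hpow : ∀ k : ℕ, ((MvPolynomial.X 0 - MvPolynomial.C (t) :
      MvPolynomial (Fin (D + 1)) ℝ) ^ k).totalDegree = k := by
    intro k
    induction k with
    | zero => simp
    | succ k ih =>
      rw [pow_succ, MvPolynomial.totalDegree_mul_of_isDomain (pow_ne_zero _ hne) hne, ih, h1]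
  have hy' := (Set.ext_iff.1 hX y).2 hy
    (q * (MvPolynomial.X 0 - MvPolynomial.C (t)) ^ (n - q.totalDegree))
    (by rw [MvPolynomial.totalDegree_mul_of_isDomain hq0 (pow_ne_zero _ hne), hpow]; omega)
    (fun z hz => by rw [map_mul, hq, hpX _ ⟨z, hz, rfl⟩, zero_mul])
  simpa [ht] using hy'

lemma polyGradient_mem_orthogonal_homogenize {D n : ℕ}
    {A : AffineSubspace ℝ (EuclideanSpace ℝ (Fin D))} {x : EuclideanSpace ℝ (Fin D)} (hx : x ∈ A)
    {p : MvPolynomial (Fin (D + 1)) ℝ} (hp : p.IsHomogeneous n)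
    (h0 : ∀ y ∈ A, MvPolynomial.eval (embed y).ofLp p = 0) :
    polyGradient p (embed x) ∈ (homogenize A)ᗮ := by
  suffices homogenize A ≤ (Submodule.span ℝ {polyGradient p (embed x)})ᗮ by
    rw [Submodule.le_orthogonal_iff_le_orthogonal] at this
    exact this (Submodule.mem_span_singleton_self _)
  refine Submodule.span_le.2 ?_
  rintro _ ⟨y, hy, rfl⟩
  rw [SetLike.mem_coe, Submodule.mem_orthogonal_singleton_iff_inner_left]
  -- Euler's identity gives orthogonality to `embed x`, the line through `x` and `y` the rest.
  have h1 : inner ℝ (embed x) (polyGradient p (embed x)) = 0 :=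
    inner_polyGradient_self hp (h0 x hx)
  have h2 : inner ℝ (embed y - embed x) (polyGradient p (embed x)) = 0 := by
    rw [inner_polyGradient]
    refine sum_mul_pderiv_eq_zero_of_line _ _ p fun t => ?_
    have hA := h0 _ (AffineMap.lineMap_mem t hx hy)
    have hpt : (fun j => embed x j + (embed y - embed x) j * t) =
        (embed (AffineMap.lineMap x y t)).ofLp := by
      funext j
      refine Fin.cases ?_ (fun j => ?_) j
      · simp
      · simp [AffineMap.lineMap_apply]; ring
    rw [← hpt] at hA
    exact hA
  rw [inner_sub_left, h1, sub_zero] at h2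
  exact h2

/-- Gradients are orthogonal to the homogenization of `A i₀` because the forms vanish along it;
conversely `w` in the orthogonal complement is the gradient of a multiple of the product of the
linear form `w` with linear forms through the other homogenizations, nonzero at the point. -/
lemma span_polyGradient_eq {D n : ℕ} {A : Fin n → AffineSubspace ℝ (EuclideanSpace ℝ (Fin D))}
    {X : Set (EuclideanSpace ℝ (Fin D))}
    (hXA : X ⊆ ⋃ i, (A i : Set (EuclideanSpace ℝ (Fin D))))
    (hX : InGeneralPosition n X (⋃ i, (A i : Set (EuclideanSpace ℝ (Fin D)))))
    {x : EuclideanSpace ℝ (Fin D)} {i₀ : Fin n} (hx : x ∈ X) (hxi : x ∈ A i₀)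
    (hne : ∀ i, i ≠ i₀ → embed x ∉ homogenize (A i)) :
    (vanishingHomogeneous n (embed '' X)).map (gradientMap (embed x)) = (homogenize (A i₀))ᗮ := by
  apply le_antisymm
  · rintro _ ⟨p, hp, rfl⟩
    refine polyGradient_mem_orthogonal_homogenize hxi (mem_vanishingHomogeneous.1 hp).1 ?_
    exact fun y hy => hX.eval_embed_eq_zero hx hp (Set.mem_iUnion_of_mem i₀ hy)
  · intro w hw
    have hl : ∀ i, ∃ l ∈ (homogenize (A i))ᗮ, i ≠ i₀ → inner ℝ l (embed x) ≠ (0 : ℝ) := by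
      intro i
      by_cases hi : i = i₀
      · exact ⟨0, zero_mem _, fun h => absurd hi h⟩
      · have h := hne i hi
        rw [← (homogenize (A i)).orthogonal_orthogonal, Submodule.mem_orthogonal] at h
        push Not at h
        obtain ⟨l, hl, h⟩ := h
        exact ⟨l, hl, fun _ => h⟩
    choose l hl hlx using hl
    have hemb : ∀ i, ∀ y ∈ A i, embed y ∈ homogenize (A i) := fun i y hy =>
      Submodule.subset_span ⟨y, hy, rfl⟩
    set Q := ∏ i ∈ Finset.univ.erase i₀, linearForm (l i) with hQ
    have hQx : MvPolynomial.eval (embed x).ofLp Q ≠ 0 := by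
      rw [hQ, map_prod, Finset.prod_ne_zero_iff]
      intro i hi
      rw [eval_linearForm]
      exact hlx i (Finset.ne_of_mem_erase hi)
    have hmem : linearForm w * Q ∈ vanishingHomogeneous n (embed '' X) := by
      rw [mem_vanishingHomogeneous]
      constructor
      · have hQn : Q.IsHomogeneous (n - 1) := by
          have := MvPolynomial.IsHomogeneous.prod (Finset.univ.erase i₀)
            (fun i => linearForm (l i)) (fun _ => 1) fun i _ => isHomogeneous_linearForm (l i)
          simpa using this
        have h := (isHomogeneous_linearForm w).mul hQn
        rwa [Nat.add_sub_cancel' (Nat.one_le_iff_ne_zero.2 (Fin.pos i₀).ne')] at h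
      · rintro _ ⟨y, hy, rfl⟩
        obtain ⟨i, hi⟩ := Set.mem_iUnion.1 (hXA hy)
        rw [map_mul]
        by_cases h : i = i₀
        · subst h
          rw [eval_linearForm, Submodule.inner_left_of_mem_orthogonal (hemb _ y hi) hw, zero_mul]
        · rw [hQ, map_prod, Finset.prod_eq_zero (Finset.mem_erase.2 ⟨h, Finset.mem_univ i⟩),
            mul_zero]
          rw [eval_linearForm, Submodule.inner_left_of_mem_orthogonal (hemb _ y hi) (hl i)]
    have hw0 : inner ℝ w (embed x) = 0 :=
      Submodule.inner_left_of_mem_orthogonal (hemb _ x hxi) hw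
    refine ⟨(MvPolynomial.eval (embed x).ofLp Q)⁻¹ • (linearForm w * Q),
      Submodule.smul_mem _ _ hmem, ?_⟩
    rw [map_smul, gradientMap_apply, polyGradient_linearForm_mul Q hw0, inv_smul_smul₀ hQx]

/-! ### Recovering an affine subspace from equations -/

lemma span_image_eq_of_maximal_linearIndepOn {ι V : Type*} [AddCommGroup V] [Module ℝ V]
    {v : ι → V} {T : Finset ι}
    (hT : Maximal (fun T' : Finset ι => LinearIndepOn ℝ v (T' : Set ι)) T) :
    Submodule.span ℝ (v '' T) = Submodule.span ℝ (Set.range v) := by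
  classical
  refine le_antisymm (Submodule.span_mono (Set.image_subset_range _ _)) (Submodule.span_le.2 ?_)
  rintro _ ⟨k, rfl⟩
  by_contra hk
  have hkT : k ∉ T := fun h => hk (Submodule.subset_span ⟨k, h, rfl⟩)
  have hins : LinearIndepOn ℝ v ((insert k T : Finset ι) : Set ι) := by
    rw [Finset.coe_insert]
    exact hT.prop.insert hk
  exact hkT (hT.le_of_ge hins (Finset.subset_insert k T) (Finset.mem_insert_self k T))

lemma mem_orthogonal_span_range {ι E : Type*} [NormedAddCommGroup E] [InnerProductSpace ℝ E]
    (v : ι → E) (y : E) :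
    y ∈ (Submodule.span ℝ (Set.range v))ᗮ ↔ ∀ k, inner ℝ (v k) y = 0 := by
  rw [Submodule.mem_orthogonal]
  refine ⟨fun h k => h _ (Submodule.subset_span ⟨k, rfl⟩), fun h u hu => ?_⟩
  induction hu using Submodule.span_induction with
  | mem u hu => obtain ⟨k, rfl⟩ := hu; exact h k
  | zero => exact inner_zero_left y
  | add u w _ _ hu hw => rw [inner_add_left, hu, hw, add_zero]
  | smul r u _ hu => rw [inner_smul_left, hu, mul_zero]

/-- An affine subspace of `ℝ^D` is given by the equations `γ k + ⟪b k, y⟫ = 0` when the vectors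
`(γ k, b k)` form a basis of the orthogonal complement of its homogenization. -/
lemma eq_mk'_of_basis_orthogonal {D : ℕ} {ι : Type*} [Fintype ι] [DecidableEq ι]
    {A : AffineSubspace ℝ (EuclideanSpace ℝ (Fin D))} {x : EuclideanSpace ℝ (Fin D)} (hx : x ∈ A)
    (hA : ∀ y, embed y ∈ homogenize A ↔ y ∈ A)
    {v : ι → EuclideanSpace ℝ (Fin (D + 1))} (hv : LinearIndependent ℝ v)
    (hspan : Submodule.span ℝ (Set.range v) = (homogenize A)ᗮ)
    {γ : ι → ℝ} {B : Matrix (Fin D) ι ℝ} (hγ : ∀ k, γ k = v k 0) (hB : ∀ j k, B j k = v k j.succ) :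
    IsUnit (Bᵀ * B) ∧ A = AffineSubspace.mk' (-(WithLp.toLp 2 (B *ᵥ ((Bᵀ * B)⁻¹ *ᵥ γ))))
      (Submodule.span ℝ (Set.range fun k => WithLp.toLp 2 (B.col k)))ᗮ := by
  have hmem : ∀ y : EuclideanSpace ℝ (Fin D), y ∈ A ↔ γ + Bᵀ *ᵥ y.ofLp = 0 := by
    intro y
    rw [← hA, ← (homogenize A).orthogonal_orthogonal, ← hspan, mem_orthogonal_span_range,
      funext_iff]
    refine forall_congr' fun k => ?_
    simp [PiLp.inner_apply, Fin.sum_univ_succ, hγ, hB, Matrix.mulVec, dotProduct, mul_comm]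
  have hinj : ∀ g : ι → ℝ, B *ᵥ g = 0 → g = 0 := by
    intro g hg
    have hz : (∑ k, g k • v k) ∈ (homogenize A)ᗮ := by
      rw [← hspan]
      exact Submodule.sum_mem _ fun k _ =>
        Submodule.smul_mem _ _ (Submodule.subset_span ⟨k, rfl⟩)
    have hsucc : ∀ j : Fin D, (∑ k, g k • v k) j.succ = 0 := by
      intro j
      have := congrFun hg j
      simpa [Matrix.mulVec, dotProduct, hB, mul_comm] using this
    have h0 := Submodule.inner_left_of_mem_orthogonal ((hA x).2 hx) hz
    rw [PiLp.inner_apply, Fin.sum_univ_succ] at h0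
    simp only [hsucc] at h0
    -- The combination is a multiple of the first basis vector, while `embed x` has first entry `1`.
    have hzero : ∑ k, g k • v k = 0 := by
      ext j
      refine Fin.cases ?_ (fun j => ?_) j
      · simpa using h0
      · exact hsucc j
    exact funext (Fintype.linearIndependent_iff.1 hv g hzero)
  have hunit : IsUnit (Bᵀ * B) := by
    rw [← Matrix.mulVec_injective_iff_isUnit, ← Matrix.coe_mulVecLin, ← LinearMap.ker_eq_bot,
      Matrix.ker_mulVecLin_transpose_mul_self, LinearMap.ker_eq_bot']
    exact hinj
  refine ⟨hunit, ?_⟩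
  ext y
  have hinv : Bᵀ *ᵥ (B *ᵥ ((Bᵀ * B)⁻¹ *ᵥ γ)) = γ := by
    rw [Matrix.mulVec_mulVec, Matrix.mulVec_mulVec,
      Matrix.mul_nonsing_inv _ ((Matrix.isUnit_iff_isUnit_det _).1 hunit), Matrix.one_mulVec]
  rw [hmem, AffineSubspace.mem_mk', mem_orthogonal_span_range]
  generalize (Bᵀ * B)⁻¹ *ᵥ γ = g at hinv ⊢
  have hrow : ∀ k, inner ℝ (WithLp.toLp 2 (B.col k))
      (y -ᵥ -(WithLp.toLp 2 (B *ᵥ g))) = (γ + Bᵀ *ᵥ y.ofLp) k := by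
    intro k
    have h := congrFun hinv k
    rw [Pi.add_apply, ← h, vsub_eq_sub, sub_neg_eq_add, inner_add_right, add_comm]
    simp [PiLp.inner_apply, Matrix.mulVec, dotProduct, mul_comm]
  simp only [hrow, funext_iff, Pi.zero_apply]

end AffineASC

/-! ### Recovery of the subspaces outside the exceptional set -/

theorem mainTheorem3 {D n : ℕ} (c : Fin n → ℕ)
    (S : Fin n → Submodule ℝ (EuclideanSpace ℝ (Fin D)))
    (B : ∀ i, Matrix (Fin D) (Fin (c i)) ℝ)
    (hB : ∀ i, AffineASC.IsBasisMatrix (B i) (S i)ᗮ)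
    (hΦ : AffineASC.IsTransversal S) :
    ∃ W : Set (∀ i, Fin (c i) → ℝ),
      AffineASC.IsAlgebraicVariety W ∧ W ≠ Set.univ ∧ MeasureTheory.volume W = 0 ∧
      (∀ a, a ∉ W ↔ AffineASC.IsTransversal fun i =>
        AffineASC.homogenize (AffineASC.affineTranslate (S i) (B i) (a i))) ∧
      ∀ a, a ∉ W →
        ∀ (A : Fin n → AffineSubspace ℝ (EuclideanSpace ℝ (Fin D))),
          (∀ i, A i = AffineASC.affineTranslate (S i) (B i) (a i)) →
        ∀ (Ψ : Set (EuclideanSpace ℝ (Fin D))),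
          Ψ = ⋃ i, (A i : Set (EuclideanSpace ℝ (Fin D))) →
        ∀ (X : Set (EuclideanSpace ℝ (Fin D))), X.Finite → X ⊆ Ψ →
          AffineASC.InGeneralPosition n X Ψ →
        ∀ (s : ℕ)
          (p : Module.Basis (Fin s) ℝ (AffineASC.vanishingHomogeneous n (AffineASC.embed '' X)))
          (i₀ : Fin n) (x : EuclideanSpace ℝ (Fin D)),
          x ∈ X → x ∈ A i₀ → (∀ i, i ≠ i₀ → x ∉ A i) →
        ∀ (b' : Fin s → EuclideanSpace ℝ (Fin (D + 1))),
          (∀ k, b' k = AffineASC.polyGradient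
            (p k : MvPolynomial (Fin (D + 1)) ℝ) (AffineASC.embed x)) →
        ∀ (T : Finset (Fin s)),
          Maximal (fun T' : Finset (Fin s) => LinearIndepOn ℝ b' (T' : Set (Fin s))) T →
        ∀ (γ₁ : T → ℝ) (B₁ : Matrix (Fin D) T ℝ),
          (∀ k : T, γ₁ k = b' k 0) → (∀ (j : Fin D) (k : T), B₁ j k = b' k j.succ) →
          IsUnit (B₁ᵀ * B₁) ∧
          A i₀ = AffineSubspace.mk' (-(WithLp.toLp 2 (B₁ *ᵥ ((B₁ᵀ * B₁)⁻¹ *ᵥ γ₁))))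
            (Submodule.span ℝ (Set.range fun k => WithLp.toLp 2 (B₁.col k)))ᗮ := by
  have h0 := AffineASC.volume_exceptionalParameters hB
  refine ⟨AffineASC.exceptionalParameters S B, AffineASC.isAlgebraicVariety_iUnion_submodule _ _,
    ?_, h0, fun a => AffineASC.notMem_exceptionalParameters_iff hΦ, ?_⟩
  · intro h
    rw [h] at h0
    exact (isOpen_univ.measure_ne_zero MeasureTheory.volume Set.univ_nonempty) h0
  · intro a _ A hA Ψ hΨ X _ hXΨ hX s p i₀ x hx hxi hxne b' hb' T hT γ₁ B₁ hγ hB₁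
    subst hΨ
    have hemb : ∀ i y, AffineASC.embed y ∈ AffineASC.homogenize (A i) ↔ y ∈ A i := fun i y => by
      rw [hA i]
      exact AffineASC.embed_mem_homogenize_mk' _ y _
    have hgrad := AffineASC.span_polyGradient_eq hXΨ hX hx hxi
      fun i hi => (hemb i x).not.2 (hxne i hi)
    have hb : b' = AffineASC.gradientMap (AffineASC.embed x) ∘ Submodule.subtype _ ∘ p :=
      funext hb'
    have hspan : Submodule.span ℝ (Set.range fun k : T => b' k) =
        (AffineASC.homogenize (A i₀))ᗮ := by
      have hT' : (Set.range fun k : T => b' k) = b' '' (T : Set (Fin s)) :=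
        (Set.image_eq_range b' (T : Set (Fin s))).symm
      rw [← hgrad, hT', AffineASC.span_image_eq_of_maximal_linearIndepOn hT, hb, Set.range_comp,
        Set.range_comp, Submodule.span_image, Submodule.span_image, p.span_eq, Submodule.map_top,
        Submodule.range_subtype]
    exact AffineASC.eq_mk'_of_basis_orthogonal hxi (hemb i₀) hT.prop hspan hγ hB₁
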